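/- Let $(\mathcal K,[\cdot,\cdot])$ be a complex Krein space and let $N$ be a bounded normal operator on $\mathcal K$, i.e. $NN^+=N^+N$, where $N^+$ is the Krein space adjoint. Put $A=\frac{N+N^+}{2}$ and $B=\frac{N-N^+}{2i}$. Let $p_1,\dots,p_m\in\mathbb R[x,y]\setminus\{0\}$ be real definitizing polynomials for $N$, i.e. $[p_j(A,B)v,v]\ge 0$ for all $v\in\mathcal K$ and $j=1,\dots,m$. Let $\mathcal H_j$ be the Hilbert space completion of $\mathcal K/\ker p_j(A,B)$ with respect to $[p_j(A,B)\cdot,\cdot]$, let $\mathcal H$ be the Hilbert space completion of $\mathcal K/\ker\big(\sum_{k=1}^m p_k(A,B)\big)$ with respect to $\big[\sum_{k=1}^m p_k(A,B)\,\cdot,\cdot\big]$, and let $T_j:\mathcal H_j\to\mathcal K$ and $T:\mathcal H\to\mathcal K$ be the (bounded, injective) adjoints of the factor mappings $\mathcal K\to\mathcal H_j$ and $\mathcal K\to\mathcal H$. Thus $T_jT_j^+=p_j(A,B)$ and $TT^+=\sum_{k=1}^m p_k(A,B)$. Let $R_j:\mathcal H_j\to\mathcal H$ be the Hilbert space adjoint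 of the continuous extension of $T^+x\mapsto T_j^+x$ $(x\in\mathcal K)$ to $\mathcal H$; it satisfies $TR_j=T_j$. Let $\Theta(N)=T^{-1}NT$, the unique bounded operator on $\mathcal H$ with $T\,\Theta(N)=NT$. Denote by $\rho(\Theta(N))$ its resolvent set; if $\mathcal H=\{0\}$ this is $\mathbb C$. Then for every $j\in\{1,\dots,m\}$ \[ \Big\{z\in\mathbb C:\ |p_j(\operatorname{Re}z,\operatorname{Im}z)|>\|R_jR_j^*\|\cdot\Big|\sum_{k=1}^m p_k(\operatorname{Re}z,\operatorname{Im}z)\Big|\Big\}\subseteq\rho(\Theta(N)). \] In particular, the zeros $z\in\mathbb C$ of $\sum_{k=1}^m p_k(\operatorname{Re}z,\operatorname{Im}z)$ are contained in \[ \rho(\Theta(N))\cup\{z\in\mathbb C:\ p_j(\operatorname{Re}z,\operatorname{Im}z)=0\ \text{ for all } j=1,\dots,m\}. \] -/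

import Mathlib

/-- A Krein space. The inner product of the ambient Hilbert space `K` is the one that belongs to a
fundamental decomposition `K = K₊ [+] K₋` of the Krein space, i.e. `⟪x, y⟫ = [J x, y]`, and `J` is the
corresponding fundamental symmetry `P₊ - P₋`: a linear self-adjoint involution. The indefinite
product `[x, y] = ⟪J x, y⟫` is `kreinInner` below. -/
class KreinSpace (K : Type*) [NormedAddCommGroup K] [InnerProductSpace ℂ K] [CompleteSpace K] where
  /-- the fundamental symmetry -/
  J : K →L[ℂ] K
  adjoint_J : ContinuousLinearMap.adjoint J = J
  J_comp_J : J ∘L J = ContinuousLinearMap.id ℂ K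

noncomputable section

namespace KreinSpace

variable {K : Type*} [NormedAddCommGroup K] [InnerProductSpace ℂ K] [CompleteSpace K] [KreinSpace K]
variable {H : Type*} [NormedAddCommGroup H] [InnerProductSpace ℂ H] [CompleteSpace H]

open ContinuousLinearMap

theorem J_J (x : K) : J (J x) = x := congrArg (fun S : K →L[ℂ] K => S x) J_comp_J

theorem inner_J (x y : K) : inner ℂ (J x) y = inner ℂ x (J y) := by
  rw [← adjoint_inner_left, adjoint_J]

/-- The indefinite product `[x, y]`, linear in the first and conjugate linear in the second variable
(Mathlib's `inner` is conjugate linear in the first one). -/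
def kreinInner (x y : K) : ℂ := inner ℂ y (J x)

/-- The Krein space adjoint `C⁺` of a bounded operator on `K`: `[C x, y] = [x, C⁺ y]`. -/
def kreinAdjoint (C : K →L[ℂ] K) : K →L[ℂ] K := J ∘L adjoint C ∘L J

theorem kreinInner_kreinAdjoint (C : K →L[ℂ] K) (x y : K) :
    kreinInner (C x) y = kreinInner x (kreinAdjoint C y) := by
  simp [kreinInner, kreinAdjoint, inner_J, J_J, adjoint_inner_left]

/-- The adjoint `T⁺ : K → H` of a bounded `T : H → K` from a Hilbert space to a Krein space. -/
def adjointToHilbert (T : H →L[ℂ] K) : K →L[ℂ] H := adjoint T ∘L J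

theorem kreinInner_adjointToHilbert (T : H →L[ℂ] K) (h : H) (x : K) :
    kreinInner (T h) x = inner ℂ (adjointToHilbert T x) h := by
  simp [kreinInner, adjointToHilbert, inner_J, adjoint_inner_left]

/-- The adjoint `S⁺ : H → K` of a bounded `S : K → H` from a Krein space to a Hilbert space. -/
def adjointToKrein (S : K →L[ℂ] H) : H →L[ℂ] K := J ∘L adjoint S

theorem kreinInner_adjointToKrein (S : K →L[ℂ] H) (h : H) (x : K) :
    kreinInner (adjointToKrein S h) x = inner ℂ (S x) h := by
  simp [kreinInner, adjointToKrein, J_J, adjoint_inner_right]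

theorem adjointToHilbert_adjointToKrein (S : K →L[ℂ] H) :
    adjointToHilbert (adjointToKrein S) = S := by
  ext x
  refine ext_inner_right ℂ fun h => ?_
  rw [← kreinInner_adjointToHilbert, kreinInner_adjointToKrein]

/-! ### Normal operators and definitizing polynomials -/

/-- `N` is normal: it commutes with its Krein space adjoint. -/
def IsKreinNormal (N : K →L[ℂ] K) : Prop := Commute N (kreinAdjoint N)

/-- `A = (N + N⁺) / 2` -/
def rePart (N : K →L[ℂ] K) : K →L[ℂ] K := (1 / 2 : ℂ) • (N + kreinAdjoint N)

/-- `B = (N - N⁺) / (2i)` -/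
def imPart (N : K →L[ℂ] K) : K →L[ℂ] K := (1 / (2 * Complex.I) : ℂ) • (N - kreinAdjoint N)

/-- `p(A, B)` for a real polynomial `p` in two variables and commuting operators `A`, `B`: the sum of
`c • A ^ a * B ^ b` over the monomials `c x ^ a y ^ b` of `p`. -/
def polyOp (p : MvPolynomial (Fin 2) ℝ) (A B : K →L[ℂ] K) : K →L[ℂ] K :=
  ∑ d ∈ p.support, ((p.coeff d : ℝ) : ℂ) • (A ^ d 0 * B ^ d 1)

/-- `[Q v, v] ≥ 0` for all `v`, i.e. `[Q v, v]` is real and nonnegative. -/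
def KreinNonneg (Q : K →L[ℂ] K) : Prop :=
  ∀ v : K, 0 ≤ (kreinInner (Q v) v).re ∧ (kreinInner (Q v) v).im = 0

/-- `p` is a real definitizing polynomial for the normal operator `N`. -/
def IsDefinitizing (N : K →L[ℂ] K) (p : MvPolynomial (Fin 2) ℝ) : Prop :=
  p ≠ 0 ∧ KreinNonneg (polyOp p (rePart N) (imPart N))

/-- `p(Re z, Im z)` -/
def evalAt (p : MvPolynomial (Fin 2) ℝ) (z : ℂ) : ℝ := MvPolynomial.eval ![z.re, z.im] p

theorem KreinNonneg.sum {ι : Type*} {s : Finset ι} {Q : ι → K →L[ℂ] K}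
    (hQ : ∀ i ∈ s, KreinNonneg (Q i)) : KreinNonneg (∑ i ∈ s, Q i) := by
  intro v
  have h : kreinInner ((∑ i ∈ s, Q i) v) v = ∑ i ∈ s, kreinInner (Q i v) v := by
    simp [kreinInner]
  rw [h, Complex.re_sum, Complex.im_sum]
  exact ⟨Finset.sum_nonneg fun i hi => (hQ i hi v).1, Finset.sum_eq_zero fun i hi => (hQ i hi v).2⟩

theorem commute_polyOp {N : K →L[ℂ] K} (hN : IsKreinNormal N) (p : MvPolynomial (Fin 2) ℝ) :
    Commute N (polyOp p (rePart N) (imPart N)) := by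
  have hA : Commute N (rePart N) := ((Commute.refl N).add_right hN).smul_right _
  have hB : Commute N (imPart N) := ((Commute.refl N).sub_right hN).smul_right _
  exact Commute.sum_right _ _ _ fun d _ =>
    ((hA.pow_right _).mul_right (hB.pow_right _)).smul_right _

/-! ### The Hilbert space completion of `(K / ker Q, [Q ·, ·])` -/

/-- The vector space `K`, to be provided with the positive semidefinite product `[Q ·, ·]`. -/
def PreSpace (Q : K →L[ℂ] K) (_hQ : KreinNonneg Q) : Type _ := K

instance (Q : K →L[ℂ] K) (hQ : KreinNonneg Q) : AddCommGroup (PreSpace Q hQ) :=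
  inferInstanceAs (AddCommGroup K)

instance (Q : K →L[ℂ] K) (hQ : KreinNonneg Q) : Module ℂ (PreSpace Q hQ) :=
  inferInstanceAs (Module ℂ K)

theorem KreinNonneg.isPositive {Q : K →L[ℂ] K} (hQ : KreinNonneg Q) : (J ∘L Q).IsPositive := by
  rw [isPositive_iff_complex]
  intro x
  have h := hQ x
  have e : inner ℂ ((J ∘L Q) x) x = starRingEnd ℂ (kreinInner (Q x) x) := by
    simp [kreinInner]
  rw [e]
  refine ⟨?_, by simpa using h.1⟩
  apply Complex.ext <;> simp [h.2]

/-- The product `[Q ·, ·]`. In Mathlib's order of the arguments: `inner x y = [Q y, x]`. -/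
abbrev preCore (Q : K →L[ℂ] K) (hQ : KreinNonneg Q) : PreInnerProductSpace.Core ℂ (PreSpace Q hQ) where
  inner x y := kreinInner (K := K) (Q y) x
  conj_inner_symm x y := by
    have h := hQ.isPositive.isSymmetric x y
    exact (inner_conj_symm _ _).trans h
  re_inner_nonneg x := (hQ x).1
  add_left x y z := by
    simp only [kreinInner]
    exact inner_add_left (𝕜 := ℂ) (E := K) x y _
  smul_left x y r := by
    simp only [kreinInner]
    exact inner_smul_left (𝕜 := ℂ) (E := K) x _ r

instance (Q : K →L[ℂ] K) (hQ : KreinNonneg Q) : SeminormedAddCommGroup (PreSpace Q hQ) :=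
  @InnerProductSpace.Core.toSeminormedAddCommGroup ℂ _ _ _ _ (preCore Q hQ)

instance (Q : K →L[ℂ] K) (hQ : KreinNonneg Q) : InnerProductSpace ℂ (PreSpace Q hQ) :=
  InnerProductSpace.ofCore (preCore Q hQ)

theorem preSpace_inner (Q : K →L[ℂ] K) (hQ : KreinNonneg Q) (x y : PreSpace Q hQ) :
    inner ℂ x y = kreinInner (K := K) (Q y) x := rfl

/-- The Hilbert space completion of `K / ker Q` with respect to `[Q ·, ·]`. (The null vectors of the
positive semidefinite `[Q ·, ·]` form `ker Q`, and `UniformSpace.Completion` is the Hausdorff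
completion, which identifies vectors whose difference is a null vector.) -/
abbrev HilbertOf (Q : K →L[ℂ] K) (hQ : KreinNonneg Q) : Type _ :=
  UniformSpace.Completion (PreSpace Q hQ)

/-- The identity mapping of the vector space `K`. -/
def toPre (Q : K →L[ℂ] K) (hQ : KreinNonneg Q) : K →ₗ[ℂ] PreSpace Q hQ where
  toFun x := x
  map_add' _ _ := rfl
  map_smul' _ _ := rfl

theorem norm_toPre_le (Q : K →L[ℂ] K) (hQ : KreinNonneg Q) (x : K) :
    ‖toPre Q hQ x‖ ≤ √‖J ∘L Q‖ * ‖x‖ := by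
  have h1 : ‖toPre Q hQ x‖ ^ 2 = (kreinInner (K := K) (Q x) x).re :=
    norm_sq_eq_re_inner (𝕜 := ℂ) (toPre Q hQ x)
  have h2 : (kreinInner (K := K) (Q x) x).re ≤ ‖J ∘L Q‖ * ‖x‖ ^ 2 := by
    calc (kreinInner (K := K) (Q x) x).re ≤ ‖kreinInner (K := K) (Q x) x‖ := Complex.re_le_norm _
      _ ≤ ‖x‖ * ‖(J ∘L Q) x‖ := norm_inner_le_norm _ _
      _ ≤ ‖x‖ * (‖J ∘L Q‖ * ‖x‖) := by gcongr; exact le_opNorm _ _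
      _ = _ := by ring
  refine le_of_sq_le_sq ?_ (by positivity)
  rw [mul_pow, Real.sq_sqrt (norm_nonneg _), h1]
  exact h2

/-- The factor mapping `x ↦ x + ker Q` of `K` into the Hilbert space `HilbertOf Q`. -/
def factorMap (Q : K →L[ℂ] K) (hQ : KreinNonneg Q) : K →L[ℂ] HilbertOf Q hQ :=
  UniformSpace.Completion.toComplL ∘L
    LinearMap.mkContinuous (toPre Q hQ) (√‖J ∘L Q‖) (norm_toPre_le Q hQ)

theorem factorMap_apply (Q : K →L[ℂ] K) (hQ : KreinNonneg Q) (x : K) :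
    factorMap Q hQ x = (toPre Q hQ x : HilbertOf Q hQ) := rfl

theorem inner_factorMap (Q : K →L[ℂ] K) (hQ : KreinNonneg Q) (x y : K) :
    inner ℂ (factorMap Q hQ x) (factorMap Q hQ y) = kreinInner (Q y) x := by
  rw [factorMap_apply, factorMap_apply, UniformSpace.Completion.inner_coe, preSpace_inner]
  rfl

theorem denseRange_factorMap (Q : K →L[ℂ] K) (hQ : KreinNonneg Q) :
    DenseRange (factorMap Q hQ) :=
  UniformSpace.Completion.denseRange_coe (α := PreSpace Q hQ)

/-- The mapping `T : HilbertOf Q → K`: the adjoint of the factor mapping. -/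
def embedding (Q : K →L[ℂ] K) (hQ : KreinNonneg Q) : HilbertOf Q hQ →L[ℂ] K :=
  adjointToKrein (factorMap Q hQ)

theorem adjointToHilbert_embedding (Q : K →L[ℂ] K) (hQ : KreinNonneg Q) :
    adjointToHilbert (embedding Q hQ) = factorMap Q hQ :=
  adjointToHilbert_adjointToKrein _

theorem embedding_injective (Q : K →L[ℂ] K) (hQ : KreinNonneg Q) :
    Function.Injective (embedding Q hQ) := by
  rw [injective_iff_map_eq_zero]
  intro h h0
  refine (denseRange_factorMap Q hQ).eq_zero_of_inner_right ℂ ?_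
  intro x
  rw [← kreinInner_adjointToKrein]
  change kreinInner (embedding Q hQ h) x = 0
  simp [h0, kreinInner]

/-- `T T⁺ = Q` -/
theorem embedding_comp_adjoint (Q : K →L[ℂ] K) (hQ : KreinNonneg Q) :
    embedding Q hQ ∘L adjointToHilbert (embedding Q hQ) = Q := by
  rw [adjointToHilbert_embedding]
  ext y
  have h : ∀ x, kreinInner (embedding Q hQ (factorMap Q hQ y)) x = kreinInner (Q y) x := fun x => by
    rw [embedding, kreinInner_adjointToKrein, inner_factorMap]
  have h' : J (embedding Q hQ (factorMap Q hQ y)) = J (Q y) := ext_inner_left ℂ h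
  simpa [J_J] using congrArg (J (K := K)) h'

/-! ### The contractions `R_j` -/

/-- For operators `P`, `Q` with `[P x, x] ≤ [Q x, x]`, the adjoint `R : HilbertOf P → HilbertOf Q` of
the continuous extension of `T_Q⁺ x ↦ T_P⁺ x` to a mapping `HilbertOf Q → HilbertOf P`. -/
def contraction (P Q : K →L[ℂ] K) (hP : KreinNonneg P) (hQ : KreinNonneg Q) :
    HilbertOf P hP →L[ℂ] HilbertOf Q hQ :=
  adjoint (LinearMap.extendOfNorm
    (adjointToHilbert (embedding P hP)).toLinearMap (adjointToHilbert (embedding Q hQ)).toLinearMap)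

/-- `T_P = T_Q R`, so that `R` is not a default value. -/
theorem embedding_comp_contraction (P Q : K →L[ℂ] K) (hP : KreinNonneg P) (hQ : KreinNonneg Q)
    (hPQ : KreinNonneg (Q - P)) :
    embedding Q hQ ∘L contraction P Q hP hQ = embedding P hP := by
  have hb : ∃ c : ℝ, ∀ x, ‖(factorMap P hP).toLinearMap x‖ ≤ c * ‖(factorMap Q hQ).toLinearMap x‖ := by
    refine ⟨1, fun x => ?_⟩
    rw [one_mul]
    refine le_of_sq_le_sq ?_ (norm_nonneg _)
    have h1 := norm_sq_eq_re_inner (𝕜 := ℂ) (factorMap P hP x)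
    have h2 := norm_sq_eq_re_inner (𝕜 := ℂ) (factorMap Q hQ x)
    rw [inner_factorMap] at h1 h2
    have h3 := (hPQ x).1
    have h4 : kreinInner ((Q - P) x) x = kreinInner (Q x) x - kreinInner (P x) x := by
      simp [kreinInner]
    rw [h4, Complex.sub_re] at h3
    simp only [RCLike.re_to_complex] at h1 h2
    change ‖factorMap P hP x‖ ^ 2 ≤ ‖factorMap Q hQ x‖ ^ 2
    linarith
  have key : ∀ x, LinearMap.extendOfNorm (factorMap P hP).toLinearMap
      (factorMap Q hQ).toLinearMap (factorMap Q hQ x) = factorMap P hP x := fun x =>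
    LinearMap.extendOfNorm_eq (denseRange_factorMap Q hQ) hb x
  ext h
  refine (J_J _).symm.trans (Eq.trans (congrArg J ?_) (J_J _))
  refine ext_inner_left ℂ fun x => ?_
  change kreinInner (embedding Q hQ (contraction P Q hP hQ h)) x = kreinInner (embedding P hP h) x
  rw [embedding, embedding, kreinInner_adjointToKrein, kreinInner_adjointToKrein, contraction,
    adjoint_inner_right, adjointToHilbert_embedding, adjointToHilbert_embedding, key]

/-! ### The mapping `Θ` -/

/-- If `C` commutes with `T T⁺`, then `‖T⁺ C x‖ ≤ c ‖T⁺ x‖` for some constant `c`. -/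
theorem exists_bound (T : H →L[ℂ] K) (C : K →L[ℂ] K)
    (hC : Commute C (T ∘L adjointToHilbert T)) :
    ∃ c : ℝ, ∀ x, ‖adjointToHilbert T (C x)‖ ≤ c * ‖adjointToHilbert T x‖ := by
  set S := adjointToHilbert T with hS
  set P := T ∘L S with hP
  have gram : ∀ x y, inner ℂ (S x) (S y) = kreinInner (P y) x := fun x y =>
    (kreinInner_adjointToHilbert T (S y) x).symm
  have step : ∀ D : K →L[ℂ] K, Commute D P → ∀ x,
      ‖S (D x)‖ ^ 2 ≤ ‖S (kreinAdjoint D (D x))‖ * ‖S x‖ := by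
    intro D hD x
    have h1 : inner ℂ (S (D x)) (S (D x)) = inner ℂ (S (kreinAdjoint D (D x))) (S x) := by
      rw [gram, gram]
      have : P (D x) = D (P x) := (congrArg (fun U : K →L[ℂ] K => U x) hD.eq).symm
      rw [this, kreinInner_kreinAdjoint]
    have h2 : ‖S (D x)‖ ^ 2 = ‖inner ℂ (S (D x)) (S (D x))‖ := by
      rw [inner_self_eq_norm_sq_to_K]; simp
    rw [h2, h1]
    exact norm_inner_le_norm _ _
  have adjP : ∀ x y, kreinInner (P x) y = kreinInner x (P y) := by
    intro x y
    rw [← gram, ← inner_conj_symm, gram]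
    simp [kreinInner, inner_J]
  have nondeg : ∀ u v : K, (∀ y, kreinInner u y = kreinInner v y) → u = v := by
    intro u v h
    have h' : J u = J v := ext_inner_left ℂ h
    simpa [J_J] using congrArg (J (K := K)) h'
  have adjL : ∀ (D : K →L[ℂ] K) (x y : K),
      kreinInner (kreinAdjoint D x) y = kreinInner x (D y) := by
    intro D x y
    simp [kreinInner, kreinAdjoint, J_J, adjoint_inner_right]
  have hadj : Commute (kreinAdjoint C) P := by
    ext x
    refine nondeg _ _ fun y => ?_
    have : P (C y) = C (P y) := (congrArg (fun U : K →L[ℂ] K => U y) hC.eq).symm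
    change kreinInner (kreinAdjoint C (P x)) y = kreinInner (P (kreinAdjoint C x)) y
    rw [adjL, adjP, adjP, adjL, this]
  set D := kreinAdjoint C * C with hD
  have hDP : Commute D P := hadj.mul_left hC
  have selfD : kreinAdjoint D = D := by
    ext x
    refine nondeg _ _ fun y => ?_
    rw [adjL, hD]
    change kreinInner x (kreinAdjoint C (C y)) = kreinInner (kreinAdjoint C (C x)) y
    rw [adjL, kreinInner_kreinAdjoint]
  have selfDn : ∀ n : ℕ, kreinAdjoint (D ^ n) = D ^ n := by
    intro n
    have hmove : ∀ x y, kreinInner ((D ^ n) x) y = kreinInner x ((D ^ n) y) := by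
      induction n with
      | zero => intro x y; simp
      | succ n ih =>
        intro x y
        rw [pow_succ]
        change kreinInner ((D ^ n) (D x)) y = kreinInner x ((D ^ n * D) y)
        rw [ih, kreinInner_kreinAdjoint, selfD, ← pow_succ, pow_succ']
        rfl
    ext x
    refine nondeg _ _ fun y => ?_
    rw [adjL, hmove]
  have stepn : ∀ n x, ‖S ((D ^ 2 ^ n) x)‖ ^ 2 ≤ ‖S ((D ^ 2 ^ (n + 1)) x)‖ * ‖S x‖ := by
    intro n x
    have := step (D ^ 2 ^ n) (hDP.pow_left _) x
    rw [selfDn] at this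
    have e : (D ^ 2 ^ (n + 1)) x = (D ^ 2 ^ n) ((D ^ 2 ^ n) x) := by
      rw [pow_succ 2 n, mul_two, pow_add]; rfl
    rwa [e]
  have boundD : ∀ x, ‖S (D x)‖ ≤ ‖D‖ * ‖S x‖ := by
    intro x
    rcases (norm_nonneg (S x)).eq_or_lt with hb | hb
    · have := stepn 0 x
      rw [← hb, mul_zero] at this
      have h0 : ‖S (D x)‖ = 0 := by
        have : ‖S ((D ^ 2 ^ 0) x)‖ = 0 := by nlinarith [norm_nonneg (S ((D ^ 2 ^ 0) x))]
        simpa using this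
      rw [h0, ← hb, mul_zero]
    · by_contra hcon
      push Not at hcon
      set b := ‖S x‖ with hbdef
      set a := ‖S (D x)‖ with ha
      have pw : ∀ n : ℕ, (a / b) ^ 2 ^ n * b ≤ ‖S ((D ^ 2 ^ n) x)‖ := by
        intro n
        induction n with
        | zero => simp [ha, div_mul_cancel₀ _ hb.ne']
        | succ n ih =>
          have h1 := stepn n x
          have h2 : ((a / b) ^ 2 ^ n * b) ^ 2 ≤ ‖S ((D ^ 2 ^ n) x)‖ ^ 2 :=
            pow_le_pow_left₀ (by positivity) ih 2
          have h3 : ((a / b) ^ 2 ^ (n + 1) * b) * b ≤ ‖S ((D ^ 2 ^ (n + 1)) x)‖ * b := by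
            refine le_trans (le_of_eq ?_) (h2.trans h1)
            rw [pow_succ 2 n, pow_mul]; ring
          exact le_of_mul_le_mul_right h3 hb
      have up : ∀ n : ℕ, ‖S ((D ^ 2 ^ n) x)‖ ≤ ‖S‖ * ‖x‖ * ‖D‖ ^ 2 ^ n := by
        intro n
        calc ‖S ((D ^ 2 ^ n) x)‖ ≤ ‖S‖ * ‖(D ^ 2 ^ n) x‖ := le_opNorm _ _
          _ ≤ ‖S‖ * (‖D ^ 2 ^ n‖ * ‖x‖) := by gcongr; exact le_opNorm _ _
          _ ≤ ‖S‖ * (‖D‖ ^ 2 ^ n * ‖x‖) := by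
            gcongr; exact norm_pow_le' D (by positivity)
          _ = _ := by ring
      have hab : ‖D‖ < a / b := by rwa [lt_div_iff₀ hb]
      rcases (norm_nonneg D).eq_or_lt with hd | hd
      · have := (pw 0).trans (up 0)
        rw [← hd] at this
        have hpos : 0 < a / b := hd ▸ hab
        have : 0 < (a / b) ^ 2 ^ 0 * b := by positivity
        simp at *
        linarith
      · have hr : 1 < a / b / ‖D‖ := by rwa [lt_div_iff₀ hd, one_mul]
        obtain ⟨n, hn⟩ := pow_unbounded_of_one_lt (‖S‖ * ‖x‖ / b) hr
        have h2 : (a / b / ‖D‖) ^ n ≤ (a / b / ‖D‖) ^ 2 ^ n :=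
          pow_le_pow_right₀ hr.le Nat.lt_two_pow_self.le
        have h3 := (pw n).trans (up n)
        have h4 : (a / b / ‖D‖) ^ 2 ^ n ≤ ‖S‖ * ‖x‖ / b := by
          rw [div_pow, div_le_div_iff₀ (by positivity) hb]
          exact h3
        linarith
  refine ⟨√‖D‖, fun x => ?_⟩
  refine le_of_sq_le_sq ?_ (by positivity)
  rw [mul_pow, Real.sq_sqrt (norm_nonneg _)]
  calc ‖S (C x)‖ ^ 2 ≤ ‖S (D x)‖ * ‖S x‖ := step C hC x
    _ ≤ ‖D‖ * ‖S x‖ * ‖S x‖ := by gcongr; exact boundD x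
    _ = _ := by ring

theorem kreinAdjoint_kreinAdjoint (C : K →L[ℂ] K) : kreinAdjoint (kreinAdjoint C) = C := by
  ext x
  simp [kreinAdjoint, adjoint_comp, adjoint_J, J_J]

theorem exists_theta (T : H →L[ℂ] K) (hT : Function.Injective T) (C : K →L[ℂ] K)
    (hC : Commute C (T ∘L adjointToHilbert T)) :
    ∃ D : H →L[ℂ] H, T ∘L D = C ∘L T := by
  have hdense : DenseRange (adjointToHilbert T) := by
    have h1 : (LinearMap.range (adjointToHilbert T).toLinearMap)ᗮ = ⊥ := by
      rw [Submodule.eq_bot_iff]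
      intro h hh
      apply hT
      rw [map_zero]
      have h' : J (T h) = 0 := ext_inner_left ℂ fun x => by
        have h2 := Submodule.mem_orthogonal _ _ |>.1 hh (adjointToHilbert T x) ⟨x, rfl⟩
        rw [← kreinInner_adjointToHilbert] at h2
        simpa [kreinInner] using h2
      simpa [J_J] using congrArg (J (K := K)) h'
    have h2 := Submodule.topologicalClosure_eq_top_iff.2 h1
    rw [← Submodule.dense_iff_topologicalClosure_eq_top] at h2
    exact h2
  have hself : kreinAdjoint (T ∘L adjointToHilbert T) = T ∘L adjointToHilbert T := by
    ext x
    simp [kreinAdjoint, adjointToHilbert, adjoint_comp, adjoint_J, J_J]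
  have hmul : ∀ U V : K →L[ℂ] K, kreinAdjoint (U * V) = kreinAdjoint V * kreinAdjoint U := by
    intro U V
    ext x
    simp [kreinAdjoint, mul_def, adjoint_comp, J_J]
  have hadj : Commute (kreinAdjoint C) (T ∘L adjointToHilbert T) := by
    have h := congrArg kreinAdjoint hC.eq
    rw [hmul, hmul, hself] at h
    exact h.symm
  have hb := exists_bound T (kreinAdjoint C) hadj
  set G : H →L[ℂ] H := LinearMap.extendOfNorm
    ((adjointToHilbert T) ∘L (kreinAdjoint C)).toLinearMap (adjointToHilbert T).toLinearMap with hG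
  have hGS : ∀ x, G (adjointToHilbert T x) = adjointToHilbert T (kreinAdjoint C x) := fun x =>
    LinearMap.extendOfNorm_eq hdense hb x
  refine ⟨adjoint G, ?_⟩
  ext h
  refine (J_J _).symm.trans (Eq.trans (congrArg J ?_) (J_J _))
  refine ext_inner_left ℂ fun x => ?_
  change kreinInner (T (adjoint G h)) x = kreinInner (C (T h)) x
  rw [kreinInner_adjointToHilbert, adjoint_inner_right, hGS, kreinInner_kreinAdjoint,
    kreinInner_adjointToHilbert]

/-- `Θ(C) = T⁻¹ C T` for an injective `T : H → K` and `C` in the commutant of `T T⁺`: the (unique)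
bounded operator `Θ(C)` on `H` with `T Θ(C) = C T`. -/
def Theta (T : H →L[ℂ] K) (hT : Function.Injective T) (C : K →L[ℂ] K)
    (hC : Commute C (T ∘L adjointToHilbert T)) : H →L[ℂ] H :=
  Classical.choose (exists_theta T hT C hC)

theorem comp_Theta (T : H →L[ℂ] K) (hT : Function.Injective T) (C : K →L[ℂ] K)
    (hC : Commute C (T ∘L adjointToHilbert T)) : T ∘L Theta T hT C hC = C ∘L T :=
  Classical.choose_spec (exists_theta T hT C hC)

/-! ### The objects that belong to `N` and `p_1, …, p_m` -/

section Setting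

variable {m : ℕ} (N : K →L[ℂ] K) (p : Fin m → MvPolynomial (Fin 2) ℝ)

/-- `p_j(A, B)` -/
def opP (j : Fin m) : K →L[ℂ] K := polyOp (p j) (rePart N) (imPart N)

/-- `∑_k p_k(A, B)` -/
def opSum : K →L[ℂ] K := ∑ k, opP N p k

variable {N p}

theorem opP_nonneg (hp : ∀ j, IsDefinitizing N (p j)) (j : Fin m) : KreinNonneg (opP N p j) :=
  (hp j).2

theorem opSum_nonneg (hp : ∀ j, IsDefinitizing N (p j)) : KreinNonneg (opSum N p) :=
  KreinNonneg.sum fun j _ => (hp j).2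

theorem opSum_sub_opP_nonneg (hp : ∀ j, IsDefinitizing N (p j)) (j : Fin m) :
    KreinNonneg (opSum N p - opP N p j) := by
  have h : opSum N p - opP N p j = ∑ k ∈ Finset.univ.erase j, opP N p k := by
    rw [opSum, ← Finset.add_sum_erase _ _ (Finset.mem_univ j), add_sub_cancel_left]
  rw [h]
  exact KreinNonneg.sum fun k _ => opP_nonneg hp k

/-- The Hilbert space `H_j`, the completion of `(K / ker p_j(A, B), [p_j(A, B) ·, ·])`. -/
abbrev SpaceH_j (hp : ∀ j, IsDefinitizing N (p j)) (j : Fin m) : Type _ :=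
  HilbertOf (opP N p j) (opP_nonneg hp j)

/-- The Hilbert space `H`, the completion of `(K / ker ∑_k p_k(A, B), [∑_k p_k(A, B) ·, ·])`. -/
abbrev SpaceH (hp : ∀ j, IsDefinitizing N (p j)) : Type _ :=
  HilbertOf (opSum N p) (opSum_nonneg hp)

/-- `T : H → K` -/
def mapT (hp : ∀ j, IsDefinitizing N (p j)) : SpaceH hp →L[ℂ] K :=
  embedding (opSum N p) (opSum_nonneg hp)

/-- `T_j : H_j → K` -/
def mapT_j (hp : ∀ j, IsDefinitizing N (p j)) (j : Fin m) : SpaceH_j hp j →L[ℂ] K :=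
  embedding (opP N p j) (opP_nonneg hp j)

/-- `R_j : H_j → H` -/
def mapR_j (hp : ∀ j, IsDefinitizing N (p j)) (j : Fin m) : SpaceH_j hp j →L[ℂ] SpaceH hp :=
  contraction (opP N p j) (opSum N p) (opP_nonneg hp j) (opSum_nonneg hp)

theorem mapT_comp_mapR_j (hp : ∀ j, IsDefinitizing N (p j)) (j : Fin m) :
    mapT hp ∘L mapR_j hp j = mapT_j hp j :=
  embedding_comp_contraction _ _ _ _ (opSum_sub_opP_nonneg hp j)

theorem mapT_injective (hp : ∀ j, IsDefinitizing N (p j)) : Function.Injective (mapT hp) :=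
  embedding_injective _ _

theorem commute_mapT (hN : IsKreinNormal N) (hp : ∀ j, IsDefinitizing N (p j)) :
    Commute N (mapT hp ∘L adjointToHilbert (mapT hp)) := by
  rw [mapT, embedding_comp_adjoint]
  exact Commute.sum_right _ _ _ fun j _ => commute_polyOp hN (p j)

/-- `Θ(N)`, a bounded operator on `H` -/
def thetaN (hN : IsKreinNormal N) (hp : ∀ j, IsDefinitizing N (p j)) : SpaceH hp →L[ℂ] SpaceH hp :=
  Theta (mapT hp) (mapT_injective hp) N (commute_mapT hN hp)

end Setting

end KreinSpace

end

/-! Write `D` for `Θ(N)`, so `T D = N T`. Since `T⁺` has dense range and `T T⁺` commutes with `N`,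
also `T D* = N⁺ T`; as `T` is injective, normality of `N` passes to `D` (`isStarNormal_of_comp`).
This moves the problem from the Krein space to a normal operator on a Hilbert space, where the
continuous functional calculus is available.

`T` then intertwines `p(Re D, Im D)` with `p(A, B)` for every real polynomial `p`. Cancelling `T` in
`T (T⁺ T) = (T T⁺) T` gives `∑ p_k(D) = T⁺ T`, and `p_j(A, B) = T_j T_j⁺ = T R_j R_j* T⁺` gives the
factorization `p_j(D) = R_j R_j* ∑ p_k(D)` (`normalPolynomial_eq_mul_sum`).

A factorization `f(D) = w g(D)` forces `|f| ≤ ‖w‖ |g|` on the spectrum (`norm_le_of_cfc_eq_mul`),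
because `f(D)* f(D) = g(D)* w* w g(D) ≤ ‖w‖² g(D)* g(D)`. Points violating this bound for `f = p_j`,
`g = ∑ p_k`, `w = R_j R_j*` therefore lie in the resolvent set. -/

open ContinuousLinearMap

/-! ### Real polynomials of a normal element and spectral bounds -/

section NormalPolynomial

variable {𝓐 : Type*} [CStarAlgebra 𝓐]

/-- `p(Re a, Im a)` for a normal `a`, by the continuous functional calculus. -/
noncomputable def normalPolynomial (p : MvPolynomial (Fin 2) ℝ) (a : 𝓐) : 𝓐 :=
  cfc (fun z : ℂ => (KreinSpace.evalAt p z : ℂ)) a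

theorem ofReal_evalAt (p : MvPolynomial (Fin 2) ℝ) (z : ℂ) :
    (KreinSpace.evalAt p z : ℂ) =
      ∑ d ∈ p.support, ((p.coeff d : ℝ) : ℂ) * ((z.re : ℂ) ^ d 0 * (z.im : ℂ) ^ d 1) := by
  simp [KreinSpace.evalAt, MvPolynomial.eval_eq', Fin.prod_univ_two]

theorem continuous_ofReal_evalAt (p : MvPolynomial (Fin 2) ℝ) :
    Continuous fun z : ℂ => (KreinSpace.evalAt p z : ℂ) := by
  simp only [ofReal_evalAt]
  fun_prop

theorem cfc_ofReal_re (a : 𝓐) [IsStarNormal a] :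
    cfc (fun z : ℂ => (z.re : ℂ)) a = (1 / 2 : ℂ) • (a + star a) := by
  have h : (fun z : ℂ => (z.re : ℂ)) = fun z => (1 / 2 : ℂ) • (z + star z) := by
    ext z
    rw [Complex.re_eq_add_conj, smul_eq_mul, starRingEnd_apply]
    ring
  rw [h, cfc_smul .., cfc_add .., cfc_id' .., cfc_star_id ..]

theorem cfc_ofReal_im (a : 𝓐) [IsStarNormal a] :
    cfc (fun z : ℂ => (z.im : ℂ)) a = (1 / (2 * Complex.I) : ℂ) • (a - star a) := by
  have h : (fun z : ℂ => (z.im : ℂ)) = fun z => (1 / (2 * Complex.I) : ℂ) • (z - star z) := by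
    ext z
    rw [Complex.im_eq_sub_conj, smul_eq_mul, starRingEnd_apply]
    ring
  rw [h, cfc_smul .., cfc_sub .., cfc_id' .., cfc_star_id ..]

/-- Brings the functional calculus into the monomial form of `polyOp`, so that intertwining
relations can be checked on the real and imaginary parts alone. -/
theorem normalPolynomial_eq_sum (p : MvPolynomial (Fin 2) ℝ) (a : 𝓐) [IsStarNormal a] :
    normalPolynomial p a = ∑ d ∈ p.support, ((p.coeff d : ℝ) : ℂ) •
      (((1 / 2 : ℂ) • (a + star a)) ^ d 0 *
        ((1 / (2 * Complex.I) : ℂ) • (a - star a)) ^ d 1) := by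
  have h : (fun z : ℂ => (KreinSpace.evalAt p z : ℂ)) =
      fun z => ∑ d ∈ p.support,
        ((p.coeff d : ℝ) : ℂ) • ((z.re : ℂ) ^ d 0 * (z.im : ℂ) ^ d 1) :=
    funext (ofReal_evalAt p)
  -- `cfc_sum` expects a sum of functions, not a function whose values are sums.
  have hfun : (fun z : ℂ => ∑ d ∈ p.support,
        ((p.coeff d : ℝ) : ℂ) • ((z.re : ℂ) ^ d 0 * (z.im : ℂ) ^ d 1)) =
      ∑ d ∈ p.support, fun z : ℂ =>
        ((p.coeff d : ℝ) : ℂ) • ((z.re : ℂ) ^ d 0 * (z.im : ℂ) ^ d 1) := by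
    ext z
    simp
  rw [normalPolynomial, h, hfun, cfc_sum _ _ _ fun d _ => by fun_prop]
  refine Finset.sum_congr rfl fun d _ => ?_
  rw [cfc_smul .., cfc_mul .., cfc_pow .., cfc_pow .., cfc_ofReal_re, cfc_ofReal_im]

open scoped ComplexOrder in
/-- If `f(a) = w g(a)` for a normal `a`, then `|f| ≤ ‖w‖ |g|` on the spectrum of `a`. -/
theorem norm_le_of_cfc_eq_mul [PartialOrder 𝓐] [StarOrderedRing 𝓐] {a w : 𝓐} [IsStarNormal a]
    {f g : ℂ → ℂ} (hf : Continuous f) (hg : Continuous g) (h : cfc f a = w * cfc g a)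
    {z : ℂ} (hz : z ∈ spectrum ℂ a) : ‖f z‖ ≤ ‖w‖ * ‖g z‖ := by
  -- This is `w* w ≤ ‖w‖²` conjugated by `g(a)`; the constant stands in the middle to match the
  -- shape of a conjugation.
  have h1 : cfc (fun z => star (f z) * f z) a ≤
      cfc (fun z => star (g z) * ((‖w‖ ^ 2 : ℝ) : ℂ) * g z) a := by
    rw [cfc_mul .., cfc_mul .., cfc_mul .., cfc_star, cfc_star, h, star_mul, cfc_const ..]
    have h2 := star_left_conjugate_le_conjugate
      (CStarAlgebra.star_mul_le_algebraMap_norm_sq (a := w)) (cfc g a)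
    simpa [mul_assoc, IsScalarTower.algebraMap_apply ℝ ℂ 𝓐] using h2
  -- For a normal element, the order between functions of it is the pointwise order on the spectrum.
  rw [cfc_le_iff _ _ a (by fun_prop) (by fun_prop)] at h1
  have h3 := (Complex.le_def.1 (h1 z hz)).1
  refine le_of_sq_le_sq ?_ (by positivity)
  have e1 : (star (f z) * f z).re = ‖f z‖ ^ 2 := by
    rw [← Complex.normSq_eq_norm_sq, Complex.normSq_apply]
    simp
  have e2 : (star (g z) * ((‖w‖ ^ 2 : ℝ) : ℂ) * g z).re = (‖w‖ * ‖g z‖) ^ 2 := by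
    rw [mul_pow, ← Complex.normSq_eq_norm_sq (g z), Complex.normSq_apply]
    simp only [Complex.mul_re, Complex.mul_im, Complex.ofReal_re, Complex.ofReal_im,
      RCLike.star_def, Complex.conj_re, Complex.conj_im]
    ring
  rwa [e1, e2] at h3

end NormalPolynomial

/-! ### Cancelling and iterating intertwiners -/

namespace ContinuousLinearMap

variable {K H : Type*} [NormedAddCommGroup K] [NormedSpace ℂ K] [NormedAddCommGroup H]
  [NormedSpace ℂ H]

theorem eq_of_comp_eq {T : H →L[ℂ] K} (hT : Function.Injective T) {C D : H →L[ℂ] H}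
    (h : T ∘L C = T ∘L D) : C = D := by
  ext x
  exact hT (DFunLike.congr_fun h x)

theorem comp_pow_of_comp {T : H →L[ℂ] K} {C : K →L[ℂ] K} {D : H →L[ℂ] H}
    (h : T ∘L D = C ∘L T) (n : ℕ) :
    T ∘L (D ^ n) = (C ^ n) ∘L T := by
  induction n with
  | zero => ext x; simp
  | succ n ih =>
    rw [pow_succ, pow_succ, mul_def, mul_def, ← comp_assoc, ih, comp_assoc, h, comp_assoc]

end ContinuousLinearMap

/-! ### Transfer from the Krein space to the Hilbert space -/

namespace KreinSpace

variable {K : Type*} [NormedAddCommGroup K] [InnerProductSpace ℂ K] [CompleteSpace K] [KreinSpace K]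
variable {H : Type*} [NormedAddCommGroup H] [InnerProductSpace ℂ H] [CompleteSpace H]

theorem adjointToHilbert_comp {G : Type*} [NormedAddCommGroup G] [InnerProductSpace ℂ G]
    [CompleteSpace G] (T : H →L[ℂ] K) (R : G →L[ℂ] H) :
    adjointToHilbert (T ∘L R) = adjoint R ∘L adjointToHilbert T := by
  rw [adjointToHilbert, adjoint_comp, comp_assoc, adjointToHilbert]

theorem adjointToHilbert_comp_left (C : K →L[ℂ] K) (T : H →L[ℂ] K) :
    adjointToHilbert (C ∘L T) = adjointToHilbert T ∘L kreinAdjoint C := by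
  ext x
  simp [adjointToHilbert, kreinAdjoint, adjoint_comp, J_J]

theorem kreinAdjoint_mul (C D : K →L[ℂ] K) :
    kreinAdjoint (C * D) = kreinAdjoint D * kreinAdjoint C := by
  ext x
  simp [kreinAdjoint, mul_def, adjoint_comp, J_J]

theorem kreinAdjoint_comp_adjointToHilbert (T : H →L[ℂ] K) :
    kreinAdjoint (T ∘L adjointToHilbert T) = T ∘L adjointToHilbert T := by
  ext x
  simp [kreinAdjoint, adjointToHilbert, adjoint_comp, adjoint_J, J_J]

/-- An intertwiner of `D` and `N` also intertwines their adjoints. -/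
theorem comp_adjoint_of_comp {T : H →L[ℂ] K} (hT : DenseRange (adjointToHilbert T))
    {N : K →L[ℂ] K} (hN : Commute N (T ∘L adjointToHilbert T)) {D : H →L[ℂ] H}
    (hD : T ∘L D = N ∘L T) : T ∘L adjoint D = kreinAdjoint N ∘L T := by
  have h1 : adjoint D ∘L adjointToHilbert T = adjointToHilbert T ∘L kreinAdjoint N := by
    rw [← adjointToHilbert_comp, hD, adjointToHilbert_comp_left]
  have h2 : (T ∘L adjointToHilbert T) * kreinAdjoint N =
      kreinAdjoint N * (T ∘L adjointToHilbert T) := by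
    have h := congrArg kreinAdjoint hN.eq
    rwa [kreinAdjoint_mul, kreinAdjoint_mul, kreinAdjoint_comp_adjointToHilbert] at h
  -- On the dense range of `T⁺` both sides agree: `T D* T⁺ = T T⁺ N⁺ = N⁺ T T⁺`.
  refine ContinuousLinearMap.coeFn_injective <|
    hT.equalizer (map_continuous _) (map_continuous _) (funext fun x => ?_)
  have h3 := DFunLike.congr_fun h1 x
  have h4 := DFunLike.congr_fun h2 x
  simp only [comp_apply, Function.comp_apply] at h3 ⊢
  rw [h3]
  exact h4

/-- `T D D* = N N⁺ T = N⁺ N T = T D* D`, and the injective `T` cancels. -/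
theorem isStarNormal_of_comp {T : H →L[ℂ] K} (hT : Function.Injective T)
    {N : K →L[ℂ] K} (hN : IsKreinNormal N) {D : H →L[ℂ] H} (hD : T ∘L D = N ∘L T)
    (hD' : T ∘L adjoint D = kreinAdjoint N ∘L T) : IsStarNormal D := by
  refine ⟨eq_of_comp_eq hT ?_⟩
  have hN' : N ∘L kreinAdjoint N = kreinAdjoint N ∘L N := hN.eq
  rw [star_eq_adjoint, mul_def, mul_def, ← comp_assoc, ← comp_assoc, hD, hD', comp_assoc,
    comp_assoc, hD, hD', ← comp_assoc, ← comp_assoc, hN']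

/-- Intertwining both `D` with `N` and `D*` with `N⁺` gives it for the real and imaginary parts,
hence for monomials and their linear combinations. -/
theorem comp_normalPolynomial {T : H →L[ℂ] K} {N : K →L[ℂ] K} {D : H →L[ℂ] H} [IsStarNormal D]
    (hD : T ∘L D = N ∘L T) (hD' : T ∘L adjoint D = kreinAdjoint N ∘L T)
    (p : MvPolynomial (Fin 2) ℝ) :
    T ∘L normalPolynomial p D = polyOp p (rePart N) (imPart N) ∘L T := by
  have hA : T ∘L ((1 / 2 : ℂ) • (D + star D)) = rePart N ∘L T := by
    rw [rePart, star_eq_adjoint, comp_smul, comp_add, hD, hD', smul_comp, add_comp]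
  have hB : T ∘L ((1 / (2 * Complex.I) : ℂ) • (D - star D)) = imPart N ∘L T := by
    rw [imPart, star_eq_adjoint, comp_smul, comp_sub, hD, hD', smul_comp, sub_comp]
  rw [normalPolynomial_eq_sum, polyOp, comp_finsetSum, finsetSum_comp]
  refine Finset.sum_congr rfl fun d _ => ?_
  rw [comp_smul, smul_comp, mul_def, mul_def, ← comp_assoc, comp_pow_of_comp hA, comp_assoc, comp_pow_of_comp hB,
    comp_assoc]

/-- If `T T⁺ = ∑_k p_k(A, B)` and `(T R) (T R)⁺ = p_j(A, B)`, then
`Θ(p_j(A, B)) = R R^* Θ(∑_k p_k(A, B))`. -/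
theorem normalPolynomial_eq_mul_sum {G : Type*} [NormedAddCommGroup G] [InnerProductSpace ℂ G]
    [CompleteSpace G] {ι : Type*} [Fintype ι] {p : ι → MvPolynomial (Fin 2) ℝ} {j : ι}
    {T : H →L[ℂ] K} (hT : Function.Injective T) {N : K →L[ℂ] K} {D : H →L[ℂ] H} [IsStarNormal D]
    (hD : T ∘L D = N ∘L T) (hD' : T ∘L adjoint D = kreinAdjoint N ∘L T) {R : G →L[ℂ] H}
    (hsum : T ∘L adjointToHilbert T = ∑ k, polyOp (p k) (rePart N) (imPart N))
    (hj : (T ∘L R) ∘L adjointToHilbert (T ∘L R) = polyOp (p j) (rePart N) (imPart N)) :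
    normalPolynomial (p j) D = (R ∘L adjoint R) * ∑ k, normalPolynomial (p k) D := by
  have hpoly := comp_normalPolynomial hD hD'
  -- After composing with `T`, both sides equal `(T T⁺) T`.
  have h : ∑ k, normalPolynomial (p k) D = adjointToHilbert T ∘L T := by
    apply eq_of_comp_eq hT
    rw [← comp_assoc, hsum, comp_finsetSum, finsetSum_comp]
    exact Finset.sum_congr rfl fun k _ => hpoly (p k)
  apply eq_of_comp_eq hT
  -- By `(T R)⁺ = R* T⁺`, both sides become `T R R* T⁺ T` up to bracketing.
  rw [h, hpoly, ← hj, adjointToHilbert_comp]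
  rfl

theorem abs_evalAt_le_of_comp {G : Type*} [NormedAddCommGroup G] [InnerProductSpace ℂ G]
    [CompleteSpace G] {ι : Type*} [Fintype ι] {p : ι → MvPolynomial (Fin 2) ℝ} {j : ι}
    {T : H →L[ℂ] K} (hT : Function.Injective T) {N : K →L[ℂ] K} {D : H →L[ℂ] H} [IsStarNormal D]
    (hD : T ∘L D = N ∘L T) (hD' : T ∘L adjoint D = kreinAdjoint N ∘L T) {R : G →L[ℂ] H}
    (hsum : T ∘L adjointToHilbert T = ∑ k, polyOp (p k) (rePart N) (imPart N))
    (hj : (T ∘L R) ∘L adjointToHilbert (T ∘L R) = polyOp (p j) (rePart N) (imPart N))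
    {z : ℂ} (hz : z ∈ spectrum ℂ D) :
    |evalAt (p j) z| ≤ ‖R ∘L adjoint R‖ * |∑ k, evalAt (p k) z| := by
  have h := normalPolynomial_eq_mul_sum hT hD hD' hsum hj
  simp only [normalPolynomial] at h
  rw [← cfc_sum (fun k z => (evalAt (p k) z : ℂ)) D Finset.univ
    fun k _ => (continuous_ofReal_evalAt (p k)).continuousOn] at h
  have hg : Continuous (∑ k, fun z : ℂ => (evalAt (p k) z : ℂ)) := by
    rw [Finset.sum_fn]
    exact continuous_finsetSum _ fun k _ => continuous_ofReal_evalAt (p k)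
  have h2 := norm_le_of_cfc_eq_mul (continuous_ofReal_evalAt (p j)) hg h hz
  rwa [Finset.sum_apply, ← Complex.ofReal_sum, Complex.norm_real, Complex.norm_real] at h2

/-! ### The spectrum of `Θ(N)` -/

section Setting

variable {m : ℕ} {N : K →L[ℂ] K} {p : Fin m → MvPolynomial (Fin 2) ℝ}

theorem mapT_comp_thetaN (hN : IsKreinNormal N) (hp : ∀ j, IsDefinitizing N (p j)) :
    mapT hp ∘L thetaN hN hp = N ∘L mapT hp :=
  comp_Theta _ _ _ _

theorem mapT_comp_adjoint_thetaN (hN : IsKreinNormal N) (hp : ∀ j, IsDefinitizing N (p j)) :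
    mapT hp ∘L adjoint (thetaN hN hp) = kreinAdjoint N ∘L mapT hp := by
  refine comp_adjoint_of_comp ?_ (commute_mapT hN hp) (mapT_comp_thetaN hN hp)
  -- `T⁺` is the factor mapping, whose range is dense in the completion.
  rw [mapT, adjointToHilbert_embedding]
  exact denseRange_factorMap _ _

theorem isStarNormal_thetaN (hN : IsKreinNormal N) (hp : ∀ j, IsDefinitizing N (p j)) :
    IsStarNormal (thetaN hN hp) :=
  isStarNormal_of_comp (mapT_injective hp) hN (mapT_comp_thetaN hN hp)
    (mapT_comp_adjoint_thetaN hN hp)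

theorem abs_evalAt_le_of_mem_spectrum (hN : IsKreinNormal N) (hp : ∀ j, IsDefinitizing N (p j))
    (j : Fin m) {z : ℂ} (hz : z ∈ spectrum ℂ (thetaN hN hp)) :
    |evalAt (p j) z| ≤
      ‖mapR_j hp j ∘L adjoint (mapR_j hp j)‖ * |∑ k, evalAt (p k) z| := by
  have := isStarNormal_thetaN hN hp
  refine abs_evalAt_le_of_comp (T := mapT hp) (mapT_injective hp) (mapT_comp_thetaN hN hp)
    (mapT_comp_adjoint_thetaN hN hp) (embedding_comp_adjoint _ _) ?_ hz
  -- `T R_j = T_j` turns the remaining goal into `T_j T_j⁺ = p_j(A, B)`.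
  rw [mapT_comp_mapR_j]
  exact embedding_comp_adjoint _ _

end Setting

end KreinSpace

theorem mainTheorem11 {K : Type*} [NormedAddCommGroup K] [InnerProductSpace ℂ K] [CompleteSpace K]
    [KreinSpace K] (N : K →L[ℂ] K) (hN : KreinSpace.IsKreinNormal N)
    {m : ℕ} (p : Fin m → MvPolynomial (Fin 2) ℝ)
    (hp : ∀ j, KreinSpace.IsDefinitizing N (p j)) :
    (∀ j : Fin m,
      {z : ℂ | |KreinSpace.evalAt (p j) z| >
          ‖KreinSpace.mapR_j hp j ∘L ContinuousLinearMap.adjoint (KreinSpace.mapR_j hp j)‖ *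
            |∑ k, KreinSpace.evalAt (p k) z|} ⊆
        resolventSet ℂ (KreinSpace.thetaN hN hp)) ∧
    {z : ℂ | ∑ k, KreinSpace.evalAt (p k) z = 0} ⊆
      resolventSet ℂ (KreinSpace.thetaN hN hp) ∪
        {z : ℂ | ∀ j : Fin m, KreinSpace.evalAt (p j) z = 0} := by
  have key : ∀ j : Fin m, {z : ℂ | |KreinSpace.evalAt (p j) z| >
        ‖KreinSpace.mapR_j hp j ∘L ContinuousLinearMap.adjoint (KreinSpace.mapR_j hp j)‖ *
          |∑ k, KreinSpace.evalAt (p k) z|} ⊆ resolventSet ℂ (KreinSpace.thetaN hN hp) := by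
    intro j z hz
    by_contra hcon
    -- The spectrum is by definition the complement of the resolvent set, so `hcon` is spectrum
    -- membership.
    exact (KreinSpace.abs_evalAt_le_of_mem_spectrum hN hp j hcon).not_gt hz
  refine ⟨key, fun z hz => ?_⟩
  by_cases h : ∀ j : Fin m, KreinSpace.evalAt (p j) z = 0
  · exact Or.inr h
  · push Not at h
    obtain ⟨j, hj⟩ := h
    refine Or.inl (key j ?_)
    rw [Set.mem_ofPred_eq] at hz ⊢
    -- At a zero of the sum the bound is `0`, so any `p_j` not vanishing there exceeds it.
    rw [hz, abs_zero, mul_zero]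
    exact abs_pos.2 hj
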